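/- We work over $\mathbb{C}$ with variables $\boldsymbol{x}=(x_1,\dots,x_n)$; $R[\boldsymbol{x}]_d$ denotes the homogeneous polynomials (forms) of degree $d$ with coefficients in $R$. A border Waring rank decomposition with $r$ summands of $f\in\mathbb{C}[\boldsymbol{x}]_d$ is an expression $f=\lim_{\epsilon\to0}\sum_{k=1}^{r}L_k^d$ with $L_1,\dots,L_r\in\mathbb{C}(\epsilon)[\boldsymbol{x}]_1$ (coefficientwise limit), and the border Waring rank $\underline{\mathsf{WR}}(f)$ is the minimal number of summands in such a decomposition. **Theorem.** Let $d\ge1$ and let $f\in\mathbb{C}[\boldsymbol{x}]_d$ satisfy $\underline{\mathsf{WR}}(f)=2$. Then $f=\ell_1^d+\ell_2^d$ or $f=\ell_1^{d-1}\ell_2$ for some $\ell_1,\ell_2\in\mathbb{C}[\boldsymbol{x}]_1$. Moreover, for every border Waring rank decomposition $f=\lim_{\epsilon\to0}(L_1^d+L_2^d)$ there are $\ell_1,\ell_2\in\mathbb{C}[\boldsymbol{x}]_1$ such that one of the following holds. 1. $f=\ell_1^d+\ell_2^d$ and, up to the order of the two summands, the decomposition $L_1^d+L_2^d$ is $$(\ell_1+\epsilon\hat\ell_1)^d+(\ell_2+\epsilon\hat\ell_2)^d$$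 for some $\hat\ell_1,\hat\ell_2\in\mathbb{C}[[\epsilon]][\boldsymbol{x}]_1$. 2. $f=\ell_1^{d-1}\ell_2$ and the decomposition $L_1^d+L_2^d$ is $$\frac1{\epsilon^M}\Bigl(a\ell_1+\epsilon\hat\ell_1+\epsilon^M\bigl(\tfrac1{a^{d-1}d}\ell_2+\ell_3\bigr)\Bigr)^d-\frac1{\epsilon^M}\Bigl(a\ell_1+\epsilon\hat\ell_1+\epsilon^M(\ell_3+\epsilon\hat\ell_2)\Bigr)^d$$ for some integer $M\ge1$, some nonzero $a\in\mathbb{C}$, some $\ell_3\in\mathbb{C}[\boldsymbol{x}]_1$ and some $\hat\ell_1,\hat\ell_2\in\mathbb{C}[[\epsilon]][\boldsymbol{x}]_1$. Here "the decomposition is $A+B$" means that the summands $L_1^d$, $L_2^d$, with coefficients expanded as Laurent series in $\epsilon$, are equal to $A$ and $B$ respectively. If $d\ge3$, the case and the forms may be prescribed by $f$: whenever $f=\ell_1^d+\ell_2^d$ with $\ell_1,\ell_2\in\mathbb{C}[\boldsymbol{x}]_1$, every border Waring rank decomposition of $f$ with two summands has the form in 1 with these $\ell_1,\ell_2$; and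 whenever $f=\ell_1^{d-1}\ell_2$ with $\ell_1,\ell_2\in\mathbb{C}[\boldsymbol{x}]_1$, every such decomposition has the form in 2 with these $\ell_1,\ell_2$. -/

import Mathlib

open Filter Topology
open scoped RatFunc

noncomputable section

/-- Homogeneous linear forms in the variables `x_1, …, x_n` over a commutative ring `R`,
i.e. the set `R[x]_1`. -/
def LinForm (n : ℕ) (R : Type*) [CommRing R] : Set (MvPolynomial (Fin n) R) :=
  {ℓ | ℓ.IsHomogeneous 1}

/-- `lim_{ε → 0} F = f`, where `F ∈ ℂ(ε)[x]` and `f ∈ ℂ[x]`: each coefficient of `F`, a rational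
function of `ε`, tends to the corresponding coefficient of `f` as `ε → 0`, `ε ≠ 0`. -/
def HasLimitAtZero {n : ℕ} (F : MvPolynomial (Fin n) (RatFunc ℂ))
    (f : MvPolynomial (Fin n) ℂ) : Prop :=
  ∀ m : Fin n →₀ ℕ,
    Tendsto (fun z : ℂ => (F.coeff m).eval (RingHom.id ℂ) z) (𝓝[≠] 0) (𝓝 (f.coeff m))

/-- `L_1, …, L_r ∈ ℂ(ε)[x]_1` form a border Waring rank decomposition of `f ∈ ℂ[x]_d`, that is,
`f = lim_{ε → 0} ∑ L_k ^ d`. -/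
def IsBorderWaringDecomp {n : ℕ} (d : ℕ) (f : MvPolynomial (Fin n) ℂ) {r : ℕ}
    (L : Fin r → MvPolynomial (Fin n) (RatFunc ℂ)) : Prop :=
  (∀ k, L k ∈ LinForm n (RatFunc ℂ)) ∧ HasLimitAtZero (∑ k, L k ^ d) f

/-- The border Waring rank of a form `f` of degree `d`: the minimal number of summands in a
border Waring rank decomposition of `f`. -/
def borderWaringRank {n : ℕ} (d : ℕ) (f : MvPolynomial (Fin n) ℂ) : ℕ :=
  sInf {r : ℕ | ∃ L : Fin r → MvPolynomial (Fin n) (RatFunc ℂ), IsBorderWaringDecomp d f L}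

/-- The parameter `ε` as a Laurent series. -/
def laurentEps : LaurentSeries ℂ := HahnSeries.single (1 : ℤ) (1 : ℂ)

/-- `ℂ(ε)[x] → ℂ((ε))[x]`, Laurent expansion of the coefficients at `ε = 0`. -/
def expandRat {n : ℕ} (F : MvPolynomial (Fin n) (RatFunc ℂ)) :
    MvPolynomial (Fin n) (LaurentSeries ℂ) :=
  MvPolynomial.map (algebraMap (RatFunc ℂ) (LaurentSeries ℂ)) F

/-- The inclusion `ℂ[[ε]][x] → ℂ((ε))[x]`. -/
def ofPower {n : ℕ} (F : MvPolynomial (Fin n) (PowerSeries ℂ)) :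
    MvPolynomial (Fin n) (LaurentSeries ℂ) :=
  MvPolynomial.map (HahnSeries.ofPowerSeries ℤ ℂ) F

/-- The inclusion `ℂ[x] → ℂ[[ε]][x]`. -/
def constForm {n : ℕ} (F : MvPolynomial (Fin n) ℂ) : MvPolynomial (Fin n) (PowerSeries ℂ) :=
  MvPolynomial.map (PowerSeries.C (R := ℂ)) F

/-- The parameter `ε` as a constant of `ℂ[[ε]][x]`. -/
def powerEps (n : ℕ) : MvPolynomial (Fin n) (PowerSeries ℂ) :=
  MvPolynomial.C (PowerSeries.X (R := ℂ))

/-- The sum `L_1 ^ d + L_2 ^ d` has, up to the order of its two summands, the form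
`(ℓ₁ + ε ℓ̂₁) ^ d + (ℓ₂ + ε ℓ̂₂) ^ d` for some `ℓ̂₁, ℓ̂₂ ∈ ℂ[[ε]][x]_1`. -/
def HasSplitForm {n : ℕ} (d : ℕ) (ℓ₁ ℓ₂ : MvPolynomial (Fin n) ℂ)
    (L : Fin 2 → MvPolynomial (Fin n) (RatFunc ℂ)) : Prop :=
  ∃ h₁ ∈ LinForm n (PowerSeries ℂ), ∃ h₂ ∈ LinForm n (PowerSeries ℂ),
    ∃ π : Equiv.Perm (Fin 2),
      expandRat (L (π 0)) ^ d = ofPower (constForm ℓ₁ + powerEps n * h₁) ^ d ∧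
      expandRat (L (π 1)) ^ d = ofPower (constForm ℓ₂ + powerEps n * h₂) ^ d

/-- The sum `L_1 ^ d + L_2 ^ d` has the form
`ε^{-M} (a ℓ₁ + ε ℓ̂₁ + ε^M (ℓ₂ / (a^{d-1} d) + ℓ₃)) ^ d - ε^{-M} (a ℓ₁ + ε ℓ̂₁ + ε^M (ℓ₃ + ε ℓ̂₂)) ^ d`
for some integer `M ≥ 1`, `a ∈ ℂ` nonzero, `ℓ₃ ∈ ℂ[x]_1` and `ℓ̂₁, ℓ̂₂ ∈ ℂ[[ε]][x]_1`. -/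
def HasTangentForm {n : ℕ} (d : ℕ) (ℓ₁ ℓ₂ : MvPolynomial (Fin n) ℂ)
    (L : Fin 2 → MvPolynomial (Fin n) (RatFunc ℂ)) : Prop :=
  ∃ M : ℕ, 1 ≤ M ∧ ∃ a : ℂ, a ≠ 0 ∧ ∃ ℓ₃ ∈ LinForm n ℂ,
    ∃ h₁ ∈ LinForm n (PowerSeries ℂ), ∃ h₂ ∈ LinForm n (PowerSeries ℂ),
      expandRat (L 0) ^ d =
        MvPolynomial.C ((laurentEps ^ M)⁻¹) *
          ofPower (constForm (MvPolynomial.C a * ℓ₁) + powerEps n * h₁ + powerEps n ^ M *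
            constForm (MvPolynomial.C (1 / (a ^ (d - 1) * (d : ℂ))) * ℓ₂ + ℓ₃)) ^ d ∧
      expandRat (L 1) ^ d =
        -(MvPolynomial.C ((laurentEps ^ M)⁻¹) *
          ofPower (constForm (MvPolynomial.C a * ℓ₁) + powerEps n * h₁ + powerEps n ^ M *
            (constForm ℓ₃ + powerEps n * h₂)) ^ d)

end

/-! ### Linear forms over `ℂ` -/

/-! Expand `L 0`, `L 1` over `ℂ((ε))` and take the least `q ≥ 0` for which `A = ε^q L₁` and `B = ε^q
L₂` have coefficients in `ℂ[[ε]]`. Then `A^d + B^d = ε^(qd) G`, where `G` has constant term `f`. If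
`q = 0`, setting `ε = 0` gives the split form. If `q > 0`, the constant terms `A₀`, `B₀` are not
both zero and `A₀^d + B₀^d = 0`, so a `d`-th root of `-1` turns `B` into `B'` with `B'^d = -B^d` and
`B' ≡ A` mod `ε`. In `A^d - B'^d = (A - B') S` the factor `S` has constant term `d A₀^(d-1) ≠ 0`; as
`ε` is prime, `A - B' = ε^(qd) D`, whence `f = d A₀^(d-1) D₀`: the tangent form. This is
`exists_sub_eq_of_pow_add_pow` and `IsBorderWaringDecomp.split_or_tangent`.

For `d ≥ 3` it remains to compare two normal forms of one `f`. Rank 2 implies that `f` is not a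
`d`-th power, so in `f = ℓ^d + m^d` the forms are not proportional and `ℓ^(d-2)`, `m^(d-2)` are
linearly independent. Second derivatives along the kernels of the linear forms then determine these
forms up to scalars, which the normal forms absorb. -/

theorem LinForm.C_mul {n : ℕ} {R : Type*} [CommRing R] {ℓ : MvPolynomial (Fin n) R}
    (h : ℓ ∈ LinForm n R) (c : R) : MvPolynomial.C c * ℓ ∈ LinForm n R :=
  MvPolynomial.IsHomogeneous.C_mul h c

theorem LinForm.eval_add_smul {n : ℕ} {ℓ : MvPolynomial (Fin n) ℂ} (h : ℓ ∈ LinForm n ℂ)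
    (v w : Fin n → ℂ) (c : ℂ) :
    MvPolynomial.eval (v + c • w) ℓ = MvPolynomial.eval v ℓ + c * MvPolynomial.eval w ℓ := by
  have h' : ℓ ∈ MvPolynomial.homogeneousSubmodule (Fin n) ℂ 1 := h
  rw [MvPolynomial.homogeneousSubmodule_one_eq_span_X] at h'
  induction h' using Submodule.span_induction with
  | mem x hx => obtain ⟨i, rfl⟩ := hx; simp
  | zero => simp
  | add x y hx hy ihx ihy =>
    rw [← MvPolynomial.homogeneousSubmodule_one_eq_span_X] at hx hy
    simp only [map_add, ihx hx, ihy hy]; ring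
  | smul a x hx ih =>
    rw [← MvPolynomial.homogeneousSubmodule_one_eq_span_X] at hx
    simp only [MvPolynomial.smul_eval, ih hx]; ring

/-- The derivative in the direction `v`. -/
noncomputable def directionalDeriv {n : ℕ} (v : Fin n → ℂ) :
    Derivation ℂ (MvPolynomial (Fin n) ℂ) (MvPolynomial (Fin n) ℂ) :=
  MvPolynomial.mkDerivation ℂ fun i => MvPolynomial.C (v i)

theorem directionalDeriv_linForm {n : ℕ} {ℓ : MvPolynomial (Fin n) ℂ} (h : ℓ ∈ LinForm n ℂ)
    (v : Fin n → ℂ) : directionalDeriv v ℓ = MvPolynomial.C (MvPolynomial.eval v ℓ) := by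
  have h' : ℓ ∈ MvPolynomial.homogeneousSubmodule (Fin n) ℂ 1 := h
  rw [MvPolynomial.homogeneousSubmodule_one_eq_span_X] at h'
  induction h' using Submodule.span_induction with
  | mem x hx => obtain ⟨i, rfl⟩ := hx; simp [directionalDeriv, MvPolynomial.mkDerivation_X]
  | zero => simp
  | add x y hx hy ihx ihy =>
    rw [← MvPolynomial.homogeneousSubmodule_one_eq_span_X] at hx hy
    simp [ihx hx, ihy hy]
  | smul a x hx ih =>
    rw [← MvPolynomial.homogeneousSubmodule_one_eq_span_X] at hx
    simp [ih hx, MvPolynomial.smul_eq_C_mul]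

theorem directionalDeriv_C {n : ℕ} (v : Fin n → ℂ) (c : ℂ) :
    directionalDeriv v (MvPolynomial.C c) = 0 :=
  MvPolynomial.derivation_C _ c

theorem directionalDeriv_linForm_pow_succ {n : ℕ} {ℓ : MvPolynomial (Fin n) ℂ}
    (h : ℓ ∈ LinForm n ℂ) (v : Fin n → ℂ) (e : ℕ) :
    directionalDeriv v (ℓ ^ (e + 1)) =
      MvPolynomial.C ((e + 1 : ℂ) * MvPolynomial.eval v ℓ) * ℓ ^ e := by
  rw [Derivation.leibniz_pow, directionalDeriv_linForm h]
  simp only [Nat.add_sub_cancel, smul_eq_mul, nsmul_eq_mul, MvPolynomial.C_mul]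
  push_cast
  simp only [MvPolynomial.C_add, map_natCast, map_one]
  ring

/-- If `m p ≠ 0`, every `w` can be moved along `p` into the kernel of `m`, where `ℓ` vanishes; this
gives the factor `ℓ p / m p`. -/
theorem LinForm.exists_eq_C_mul {n : ℕ} {ℓ m : MvPolynomial (Fin n) ℂ} (hℓ : ℓ ∈ LinForm n ℂ)
    (hm : m ∈ LinForm n ℂ)
    (h : ∀ w, MvPolynomial.eval w m = 0 → MvPolynomial.eval w ℓ = 0) :
    ∃ c : ℂ, ℓ = MvPolynomial.C c * m := by
  by_cases hm0 : ∀ p, MvPolynomial.eval p m = 0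
  · exact ⟨0, MvPolynomial.funext fun p => by simp [h p (hm0 p)]⟩
  · push Not at hm0
    obtain ⟨p, hp⟩ := hm0
    refine ⟨MvPolynomial.eval p ℓ / MvPolynomial.eval p m, MvPolynomial.funext fun w => ?_⟩
    have h1 := h (w + (-(MvPolynomial.eval w m / MvPolynomial.eval p m)) • p) (by
      rw [LinForm.eval_add_smul hm]; field_simp; ring)
    rw [LinForm.eval_add_smul hℓ] at h1
    simp only [map_mul, MvPolynomial.eval_C]
    linear_combination h1

theorem LinForm.exists_eq_C_mul_of_pow {n e : ℕ} {ℓ m : MvPolynomial (Fin n) ℂ}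
    (hℓ : ℓ ∈ LinForm n ℂ) (hm : m ∈ LinForm n ℂ) (he : e ≠ 0) {α β : ℂ} (hα : α ≠ 0)
    (h : MvPolynomial.C α * ℓ ^ e + MvPolynomial.C β * m ^ e = 0) :
    ∃ c : ℂ, ℓ = MvPolynomial.C c * m := by
  refine LinForm.exists_eq_C_mul hℓ hm fun w hw => ?_
  have h1 := congrArg (MvPolynomial.eval w) h
  simp only [map_add, map_mul, map_pow, MvPolynomial.eval_C, hw, zero_pow he, mul_zero, add_zero,
    map_zero, mul_eq_zero, hα, false_or] at h1
  exact eq_zero_of_pow_eq_zero h1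

/-! ### Forms that are not powers of a linear form -/

/-- `f` is not the `d`-th power of a linear form. -/
def NotPowLinForm {n : ℕ} (d : ℕ) (f : MvPolynomial (Fin n) ℂ) : Prop :=
  ∀ ℓ ∈ LinForm n ℂ, f ≠ ℓ ^ d

theorem LinForm.exists_pow_eq_C_mul {n d : ℕ} (hd : d ≠ 0) {ℓ : MvPolynomial (Fin n) ℂ}
    (hℓ : ℓ ∈ LinForm n ℂ) (c : ℂ) : ∃ m ∈ LinForm n ℂ, MvPolynomial.C c * ℓ ^ d = m ^ d := by
  obtain ⟨z, hz⟩ := IsAlgClosed.exists_pow_nat_eq c (Nat.pos_of_ne_zero hd)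
  exact ⟨_, LinForm.C_mul hℓ z, by rw [mul_pow, ← map_pow, hz]⟩

theorem NotPowLinForm.ne_zero {n d : ℕ} (hd : d ≠ 0) {f : MvPolynomial (Fin n) ℂ}
    (h : NotPowLinForm d f) : f ≠ 0 := fun h0 =>
  h 0 (MvPolynomial.isHomogeneous_zero _ _ _) (by rw [h0, zero_pow hd])

theorem NotPowLinForm.not_proportional {n d : ℕ} (hd : d ≠ 0) {ℓ m : MvPolynomial (Fin n) ℂ}
    (h : NotPowLinForm d (ℓ ^ d + m ^ d)) (hm : m ∈ LinForm n ℂ) (c : ℂ) :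
    ℓ ≠ MvPolynomial.C c * m := by
  rintro rfl
  obtain ⟨k, hk, hk'⟩ := LinForm.exists_pow_eq_C_mul hd hm (c ^ d + 1)
  exact h k hk (by rw [← hk', mul_pow, map_add, map_pow, map_one]; ring)

/-- A nontrivial relation would make `ℓ` and `m` proportional, and `ℓ ^ d + m ^ d` a `d`-th power.
The exponent `e` is independent of `d` so that the lemma also applies to derivatives. -/
theorem NotPowLinForm.coeffs_eq_zero {n d e : ℕ} (hd : d ≠ 0) (he : e ≠ 0)
    {ℓ m : MvPolynomial (Fin n) ℂ} (h : NotPowLinForm d (ℓ ^ d + m ^ d)) (hℓ : ℓ ∈ LinForm n ℂ)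
    (hm : m ∈ LinForm n ℂ) {α β : ℂ}
    (hab : MvPolynomial.C α * ℓ ^ e + MvPolynomial.C β * m ^ e = 0) : α = 0 ∧ β = 0 := by
  constructor
  · by_contra hα
    obtain ⟨c, hc⟩ := LinForm.exists_eq_C_mul_of_pow hℓ hm he hα hab
    exact h.not_proportional hd hm c hc
  · by_contra hβ
    rw [add_comm] at hab h
    obtain ⟨c, hc⟩ := LinForm.exists_eq_C_mul_of_pow hm hℓ he hβ hab
    exact h.not_proportional hd hℓ c hc

/-! ### Second derivatives and uniqueness of the normal forms. -/

theorem directionalDeriv_directionalDeriv_pow {n e : ℕ} {ℓ : MvPolynomial (Fin n) ℂ}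
    (h : ℓ ∈ LinForm n ℂ) (v w : Fin n → ℂ) :
    directionalDeriv v (directionalDeriv w (ℓ ^ (e + 2))) =
      MvPolynomial.C ((e + 2 : ℂ) * (e + 1) * MvPolynomial.eval v ℓ * MvPolynomial.eval w ℓ) *
        ℓ ^ e := by
  rw [directionalDeriv_linForm_pow_succ h, Derivation.leibniz, directionalDeriv_C,
    directionalDeriv_linForm_pow_succ h, smul_zero, add_zero, smul_eq_mul, ← mul_assoc,
    ← MvPolynomial.C_mul]
  congr 2
  push_cast
  ring

/-- A mixed second derivative of a sum of two powers vanishes only if it vanishes on each. -/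
theorem NotPowLinForm.eval_mul_eval_eq_zero {n e : ℕ} (he : e ≠ 0) {ℓ m : MvPolynomial (Fin n) ℂ}
    (h : NotPowLinForm (e + 2) (ℓ ^ (e + 2) + m ^ (e + 2))) (hℓ : ℓ ∈ LinForm n ℂ)
    (hm : m ∈ LinForm n ℂ) {v w : Fin n → ℂ}
    (hD : directionalDeriv v (directionalDeriv w (ℓ ^ (e + 2) + m ^ (e + 2))) = 0) :
    MvPolynomial.eval v ℓ * MvPolynomial.eval w ℓ = 0 ∧
      MvPolynomial.eval v m * MvPolynomial.eval w m = 0 := by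
  rw [map_add, map_add, directionalDeriv_directionalDeriv_pow hℓ,
    directionalDeriv_directionalDeriv_pow hm] at hD
  have h2 : (e + 2 : ℂ) ≠ 0 := by exact_mod_cast (by omega : e + 2 ≠ 0)
  have h1 : (e + 1 : ℂ) ≠ 0 := by exact_mod_cast (by omega : e + 1 ≠ 0)
  -- The exponent left after two derivatives is `e = d - 2`. Here `d ≥ 3` matters: for `e = 0` both
  -- powers would be `1`.
  simpa [h1, h2] using h.coeffs_eq_zero (by omega) he hℓ hm hD

/-- Differentiating along `v ∈ ker a` and `w ∈ ker b` kills the right side, so `ℓ v * ℓ w = 0` for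
all such pairs: `ℓ` vanishes on `ker a` or on `ker b`. -/
theorem NotPowLinForm.proportional_left {n e : ℕ} (he : e ≠ 0)
    {ℓ m a b : MvPolynomial (Fin n) ℂ}
    (h : NotPowLinForm (e + 2) (ℓ ^ (e + 2) + m ^ (e + 2))) (hℓ : ℓ ∈ LinForm n ℂ)
    (hm : m ∈ LinForm n ℂ) (ha : a ∈ LinForm n ℂ) (hb : b ∈ LinForm n ℂ)
    (hab : ℓ ^ (e + 2) + m ^ (e + 2) = a ^ (e + 2) + b ^ (e + 2)) :
    (∃ c, ℓ = MvPolynomial.C c * a) ∨ ∃ c, ℓ = MvPolynomial.C c * b := by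
  by_contra! hcon
  obtain ⟨h1, h2⟩ := hcon
  have key : ∀ v w, MvPolynomial.eval v a = 0 → MvPolynomial.eval w b = 0 →
      MvPolynomial.eval v ℓ * MvPolynomial.eval w ℓ = 0 := fun v w hv hw => by
    refine (h.eval_mul_eval_eq_zero he hℓ hm ?_).1
    rw [hab, map_add, map_add, directionalDeriv_directionalDeriv_pow ha,
      directionalDeriv_directionalDeriv_pow hb]
    simp [hv, hw]
  by_cases hv : ∀ v, MvPolynomial.eval v a = 0 → MvPolynomial.eval v ℓ = 0
  · obtain ⟨c, hc⟩ := LinForm.exists_eq_C_mul hℓ ha hv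
    exact h1 c hc
  · push Not at hv
    obtain ⟨v, hva, hvl⟩ := hv
    obtain ⟨c, hc⟩ := LinForm.exists_eq_C_mul hℓ hb fun w hw =>
      (mul_eq_zero.1 (key v w hva hw)).resolve_left hvl
    exact h2 c hc

/-- Uniqueness of a decomposition as a sum of two powers of linear forms, in degree at least 3,
once the first forms are proportional. -/
theorem NotPowLinForm.unique_of_proportional {n e : ℕ} (he : e ≠ 0)
    {ℓ m a b : MvPolynomial (Fin n) ℂ}
    (h : NotPowLinForm (e + 2) (ℓ ^ (e + 2) + m ^ (e + 2))) (hℓ : ℓ ∈ LinForm n ℂ)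
    (hm : m ∈ LinForm n ℂ) (ha : a ∈ LinForm n ℂ) (hb : b ∈ LinForm n ℂ)
    (hab : ℓ ^ (e + 2) + m ^ (e + 2) = a ^ (e + 2) + b ^ (e + 2)) {c : ℂ}
    (hc : a = MvPolynomial.C c * ℓ) :
    ∃ c', b = MvPolynomial.C c' * m ∧ c ^ (e + 2) = 1 ∧ c' ^ (e + 2) = 1 := by
  have h' := h
  rw [hab, add_comm (a ^ (e + 2))] at h'
  obtain ⟨c', hc'⟩ | ⟨c', hc'⟩ := h'.proportional_left he hb ha hℓ hm 
      (by rw [add_comm, ← hab])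
  · exfalso
    -- If `b` too were a multiple of `ℓ`, then `m ^ (e + 2)` would be a multiple of `ℓ ^ (e + 2)`.
    have h3 : MvPolynomial.C (1 - c ^ (e + 2) - c' ^ (e + 2)) * ℓ ^ (e + 2) +
        MvPolynomial.C 1 * m ^ (e + 2) = 0 := by
      rw [hc, hc'] at hab
      simp only [map_sub, map_one, map_pow]
      linear_combination hab
    exact one_ne_zero (h.coeffs_eq_zero (by omega) (by omega) hℓ hm h3).2
  · have h3 : MvPolynomial.C (1 - c ^ (e + 2)) * ℓ ^ (e + 2) +
        MvPolynomial.C (1 - c' ^ (e + 2)) * m ^ (e + 2) = 0 := by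
      rw [hc, hc'] at hab
      simp only [map_sub, map_one, map_pow]
      linear_combination hab
    obtain ⟨h4, h5⟩ := h.coeffs_eq_zero (by omega) (by omega) hℓ hm h3
    exact ⟨c', hc', (sub_eq_zero.1 h4).symm, (sub_eq_zero.1 h5).symm⟩

theorem directionalDeriv_tangent {n e : ℕ} {a b : MvPolynomial (Fin n) ℂ}
    (ha : a ∈ LinForm n ℂ) (hb : b ∈ LinForm n ℂ) {v : Fin n → ℂ}
    (hv : MvPolynomial.eval v a = 0) :
    directionalDeriv v (a ^ (e + 1) * b) =
      MvPolynomial.C (MvPolynomial.eval v b) * a ^ (e + 1) := by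
  rw [Derivation.leibniz, directionalDeriv_linForm_pow_succ ha, directionalDeriv_linForm hb, hv]
  simp [mul_comm]

theorem directionalDeriv_directionalDeriv_tangent {n e : ℕ} {a b : MvPolynomial (Fin n) ℂ}
    (ha : a ∈ LinForm n ℂ) (hb : b ∈ LinForm n ℂ) {v : Fin n → ℂ}
    (hv : MvPolynomial.eval v a = 0) :
    directionalDeriv v (directionalDeriv v (a ^ (e + 1) * b)) = 0 := by
  rw [directionalDeriv_tangent ha hb hv, Derivation.leibniz, directionalDeriv_linForm_pow_succ ha,
    directionalDeriv_C, hv]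
  simp

/-- In degree at least 3 the two normal forms exclude each other. -/
theorem NotPowLinForm.split_ne_tangent {n e : ℕ} (he : e ≠ 0)
    {ℓ m a b : MvPolynomial (Fin n) ℂ}
    (h : NotPowLinForm (e + 2) (ℓ ^ (e + 2) + m ^ (e + 2))) (hℓ : ℓ ∈ LinForm n ℂ)
    (hm : m ∈ LinForm n ℂ) (ha : a ∈ LinForm n ℂ) (hb : b ∈ LinForm n ℂ) :
    ℓ ^ (e + 2) + m ^ (e + 2) ≠ a ^ (e + 1) * b := by
  intro hab
  -- For `v ∈ ker a` the second derivative of `a ^ (e + 1) * b` along `v` vanishes. So `ℓ` and `m`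
  -- are both multiples of `a`, and their powers sum to a power.
  have key : ∀ v, MvPolynomial.eval v a = 0 →
      MvPolynomial.eval v ℓ = 0 ∧ MvPolynomial.eval v m = 0 := fun v hv => by
    have h1 := h.eval_mul_eval_eq_zero he hℓ hm
      (by rw [hab]; exact directionalDeriv_directionalDeriv_tangent ha hb hv)
    exact ⟨mul_self_eq_zero.1 h1.1, mul_self_eq_zero.1 h1.2⟩
  obtain ⟨c, hc⟩ := LinForm.exists_eq_C_mul hℓ ha fun v hv => (key v hv).1
  obtain ⟨c', hc'⟩ := LinForm.exists_eq_C_mul hm ha fun v hv => (key v hv).2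
  obtain ⟨k, hk, hk'⟩ := LinForm.exists_pow_eq_C_mul (d := e + 2) (by omega) ha
    (c ^ (e + 2) + c' ^ (e + 2))
  refine h k hk ?_
  rw [← hk', hc, hc']
  simp only [map_add, map_pow]
  ring

theorem directionalDeriv_directionalDeriv_tangent' {n e : ℕ} {a b : MvPolynomial (Fin n) ℂ}
    (ha : a ∈ LinForm n ℂ) (hb : b ∈ LinForm n ℂ) (v : Fin n → ℂ) :
    directionalDeriv v (directionalDeriv v (a ^ (e + 2) * b)) =
      a ^ e * (MvPolynomial.C ((e + 2 : ℂ) * (e + 1) * MvPolynomial.eval v a ^ 2) * b +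
        MvPolynomial.C (2 * (e + 2 : ℂ) * MvPolynomial.eval v a * MvPolynomial.eval v b) * a) := by
  have h1 := directionalDeriv_linForm_pow_succ ha v (e + 1)
  have h2 := directionalDeriv_linForm_pow_succ ha v e
  simp only [Derivation.leibniz, smul_eq_mul, map_add, directionalDeriv_linForm hb,
    directionalDeriv_C, h1, h2]
  push_cast
  simp only [map_mul, map_add, map_pow, map_ofNat, map_natCast, map_one]
  ring

/-- Uniqueness of the normal form `ℓ₁ ^ (d - 1) * ℓ₂` in degree at least 3. -/
theorem NotPowLinForm.tangent_unique {n e : ℕ} {ℓ m a b : MvPolynomial (Fin n) ℂ}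
    (h : NotPowLinForm (e + 3) (a ^ (e + 2) * b)) (hℓ : ℓ ∈ LinForm n ℂ) (hm : m ∈ LinForm n ℂ)
    (ha : a ∈ LinForm n ℂ) (hb : b ∈ LinForm n ℂ) (hab : a ^ (e + 2) * b = ℓ ^ (e + 2) * m) :
    ∃ c : ℂ, c ≠ 0 ∧ a = MvPolynomial.C c * ℓ ∧ m = MvPolynomial.C (c ^ (e + 2)) * b := by
  have hf0 := h.ne_zero (by omega)
  have ha0 : a ≠ 0 := by rintro rfl; simp at hf0
  have hℓ0 : ℓ ≠ 0 := by rintro rfl; simp [hab] at hf0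
  -- For `v ∈ ker ℓ` the second derivative of `f` along `v` is zero. If `a v ≠ 0`, its linear
  -- cofactor of `a ^ (e + 1)` makes `b` a multiple of `a`, and `f` a power.
  obtain ⟨c, hc⟩ := LinForm.exists_eq_C_mul ha hℓ fun v hv => by
    have h1 := directionalDeriv_directionalDeriv_tangent (e := e + 1) hℓ hm hv
    rw [← hab, directionalDeriv_directionalDeriv_tangent' ha hb, mul_eq_zero,
      or_iff_right (pow_ne_zero _ ha0)] at h1
    by_contra hva
    have h2 : (e + 2 : ℂ) * (e + 1) * MvPolynomial.eval v a ^ 2 ≠ 0 := by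
      have h2 : (e + 2 : ℂ) ≠ 0 := by exact_mod_cast (by omega : e + 2 ≠ 0)
      have h1 : (e + 1 : ℂ) ≠ 0 := by exact_mod_cast (by omega : e + 1 ≠ 0)
      positivity
    obtain ⟨c, rfl⟩ := LinForm.exists_eq_C_mul_of_pow hb ha one_ne_zero h2
      (by rw [pow_one, pow_one]; exact h1)
    obtain ⟨k, hk, hk'⟩ := LinForm.exists_pow_eq_C_mul (d := e + 3) (by omega) ha c
    exact h k hk (by rw [← hk']; ring)
  refine ⟨c, ?_, hc, ?_⟩
  · rintro rfl
    simp [hc] at ha0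
  · rw [hc, mul_pow, mul_assoc, mul_left_comm] at hab
    rw [map_pow]
    exact (mul_left_cancel₀ (pow_ne_zero _ hℓ0) hab).symm

/-! ### Limits of rational functions and power series -/

/-- The cross-multiplied identity holds before it is known that the denominator is nonzero at `0`.
With coprimality it then excludes a pole. -/
theorem RatFunc.tendsto_num_eval {r : RatFunc ℂ} {c : ℂ}
    (h : Tendsto (fun z : ℂ => r.eval (RingHom.id ℂ) z) (𝓝[≠] 0) (𝓝 c)) :
    r.num.eval 0 = c * r.denom.eval 0 := by
  have hn : Tendsto (fun z : ℂ => r.num.eval z) (𝓝[≠] 0) (𝓝 (r.num.eval 0)) :=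
    (r.num.continuous.tendsto 0).mono_left nhdsWithin_le_nhds
  have hq : Tendsto (fun z : ℂ => r.denom.eval z) (𝓝[≠] 0) (𝓝 (r.denom.eval 0)) :=
    (r.denom.continuous.tendsto 0).mono_left nhdsWithin_le_nhds
  have hev : ∀ᶠ z in 𝓝[≠] (0 : ℂ), r.denom.eval z ≠ 0 := by
    have hfin : ({z | r.denom.eval z = 0} : Set ℂ).Finite :=
      Polynomial.finite_setOfPred_isRoot r.denom_ne_zero
    have := (hfin.subset (Set.sdiff_subset (t := {0}))).isClosed.isOpen_compl.mem_nhds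
      (x := (0 : ℂ)) (by simp)
    filter_upwards [mem_nhdsWithin_of_mem_nhds this, self_mem_nhdsWithin] with z hz hz0 hcon
    exact hz ⟨hcon, hz0⟩
  refine tendsto_nhds_unique hn ((h.mul hq).congr' ?_)
  filter_upwards [hev] with z hz
  simp only [RatFunc.eval, ← Polynomial.eval₂_id]
  rw [← Polynomial.eval₂_id] at hz
  exact div_mul_cancel₀ _ hz

theorem RatFunc.denom_eval_ne_zero_of_tendsto {r : RatFunc ℂ} {c : ℂ}
    (h : Tendsto (fun z : ℂ => r.eval (RingHom.id ℂ) z) (𝓝[≠] 0) (𝓝 c)) :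
    r.denom.eval 0 ≠ 0 := by
  intro h0
  have h1 := RatFunc.tendsto_num_eval h
  obtain ⟨a, b, hab⟩ := r.isCoprime_num_denom
  have := congrArg (Polynomial.eval 0) hab
  simp [h1, h0] at this

/-- A rational function with a limit at `0` has a Laurent expansion without negative powers,
whose constant coefficient is the limit. -/
theorem RatFunc.exists_powerSeries_of_tendsto {r : RatFunc ℂ} {c : ℂ}
    (h : Tendsto (fun z : ℂ => r.eval (RingHom.id ℂ) z) (𝓝[≠] 0) (𝓝 c)) :
    ∃ g : PowerSeries ℂ, HahnSeries.ofPowerSeries ℤ ℂ g =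
      algebraMap (RatFunc ℂ) (LaurentSeries ℂ) r ∧ PowerSeries.constantCoeff g = c := by
  have hq := RatFunc.denom_eval_ne_zero_of_tendsto h
  have hn := RatFunc.tendsto_num_eval h
  have hq' : PowerSeries.constantCoeff (r.denom : PowerSeries ℂ) ≠ 0 := by
    rwa [Polynomial.constantCoeff_coe, Polynomial.coeff_zero_eq_eval_zero]
  have hmul := PowerSeries.mul_inv_cancel _ hq'
  refine ⟨(r.num : PowerSeries ℂ) * (r.denom : PowerSeries ℂ)⁻¹, ?_, ?_⟩
  · have hd0 : HahnSeries.ofPowerSeries ℤ ℂ (r.denom : PowerSeries ℂ) ≠ 0 := by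
      intro h0
      have := congrArg (HahnSeries.ofPowerSeries ℤ ℂ) hmul
      simp [h0] at this
    conv_rhs => rw [← RatFunc.num_div_denom r, map_div₀]
    rw [eq_div_iff]
    · have e1 := RatFunc.coe_coe (F := ℂ) r.num
      have e2 := RatFunc.coe_coe (F := ℂ) r.denom
      rw [RatFunc.coePolynomial_eq_algebraMap] at e1 e2
      rw [← e1, ← e2, ← map_mul, mul_assoc, mul_comm _ (r.denom : PowerSeries ℂ), hmul, mul_one]
    · have e2 := RatFunc.coe_coe (F := ℂ) r.denom
      rw [RatFunc.coePolynomial_eq_algebraMap] at e2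
      rwa [← e2]
  · rw [map_mul, PowerSeries.constantCoeff_inv, Polynomial.constantCoeff_coe,
      Polynomial.constantCoeff_coe, Polynomial.coeff_zero_eq_eval_zero,
      Polynomial.coeff_zero_eq_eval_zero, hn, mul_assoc, mul_inv_cancel₀ hq, mul_one]

/-! ### Forms with power series coefficients -/

/-- The constant term in `ε` of a polynomial with power series coefficients. -/
noncomputable abbrev constTerm {n : ℕ} (F : MvPolynomial (Fin n) (PowerSeries ℂ)) :
    MvPolynomial (Fin n) ℂ :=
  MvPolynomial.map (PowerSeries.constantCoeff (R := ℂ)) F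

theorem ofPower_injective {n : ℕ} : Function.Injective (ofPower (n := n)) :=
  MvPolynomial.map_injective _ HahnSeries.ofPowerSeries_injective

theorem exists_ofPower_eq {n : ℕ} {P : MvPolynomial (Fin n) (LaurentSeries ℂ)}
    (h : ∀ m, ∃ g, HahnSeries.ofPowerSeries ℤ ℂ g = P.coeff m) : ∃ F, ofPower F = P := by
  refine (MvPolynomial.mem_range_map_iff_coeffs_subset
    (f := HahnSeries.ofPowerSeries ℤ ℂ) (x := P)).2 ?_
  intro x hx
  obtain ⟨m, -, rfl⟩ := MvPolynomial.mem_coeffs_iff.1 hx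
  exact h m

theorem HasLimitAtZero.exists_ofPower {n : ℕ} {F : MvPolynomial (Fin n) (RatFunc ℂ)}
    {f : MvPolynomial (Fin n) ℂ} (h : HasLimitAtZero F f) :
    ∃ G, ofPower G = expandRat F ∧ constTerm G = f := by
  choose g hg hg' using fun m => RatFunc.exists_powerSeries_of_tendsto (h m)
  obtain ⟨G, hG⟩ := exists_ofPower_eq (P := expandRat F)
    fun m => ⟨g m, by rw [hg, expandRat, MvPolynomial.coeff_map]⟩
  refine ⟨G, hG, ?_⟩
  ext m
  rw [MvPolynomial.coeff_map, ← hg' m]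
  congr 1
  refine HahnSeries.ofPowerSeries_injective (Γ := ℤ) ?_
  rw [hg, ← MvPolynomial.coeff_map, ← MvPolynomial.coeff_map]
  exact congrArg (MvPolynomial.coeff m) hG

theorem powerEps_dvd_iff {n : ℕ} {F : MvPolynomial (Fin n) (PowerSeries ℂ)} :
    powerEps n ∣ F ↔ constTerm F = 0 :=
  MvPolynomial.C_dvd_iff_map_hom_eq_zero _ _ (fun _ => PowerSeries.X_dvd_iff.symm) F

theorem constTerm_constForm {n : ℕ} (f : MvPolynomial (Fin n) ℂ) :
    constTerm (constForm f) = f := by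
  rw [constTerm, constForm, MvPolynomial.map_map]
  convert MvPolynomial.map_id f
  ext; simp

theorem constTerm_powerEps (n : ℕ) : constTerm (powerEps n) = 0 := by
  simp [constTerm, powerEps]

theorem powerEps_ne_zero (n : ℕ) : powerEps n ≠ 0 := by
  simp [powerEps, PowerSeries.X_ne_zero]

theorem ofPower_powerEps (n : ℕ) : ofPower (powerEps n) = MvPolynomial.C laurentEps := by
  simp [ofPower, powerEps, laurentEps]

theorem laurentEps_ne_zero : laurentEps ≠ 0 := by
  simp [laurentEps]

theorem LinForm.map {n : ℕ} {R S : Type*} [CommRing R] [CommRing S]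
    {ℓ : MvPolynomial (Fin n) R} (h : ℓ ∈ LinForm n R) (φ : R →+* S) :
    MvPolynomial.map φ ℓ ∈ LinForm n S :=
  MvPolynomial.IsHomogeneous.map h φ

theorem LinForm.of_powerEps_mul {n : ℕ} {F : MvPolynomial (Fin n) (PowerSeries ℂ)}
    (h : powerEps n * F ∈ LinForm n (PowerSeries ℂ)) : F ∈ LinForm n (PowerSeries ℂ) := by
  intro m hm
  refine h (d := m) ?_
  rw [powerEps, MvPolynomial.coeff_C_mul]
  exact mul_ne_zero PowerSeries.X_ne_zero hm

/-- A linear form over `ℂ[[ε]]` is the sum of its constant term and a multiple of `ε`. -/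
theorem LinForm.exists_eq_constForm_add {n : ℕ} {A : MvPolynomial (Fin n) (PowerSeries ℂ)}
    (hA : A ∈ LinForm n (PowerSeries ℂ)) :
    ∃ A' ∈ LinForm n (PowerSeries ℂ), A = constForm (constTerm A) + powerEps n * A' := by
  have h1 : constTerm (A - constForm (constTerm A)) = 0 := by
    rw [constTerm, map_sub, ← constTerm, ← constTerm, constTerm_constForm, sub_self]
  obtain ⟨A', hA'⟩ := powerEps_dvd_iff.2 h1
  refine ⟨A', LinForm.of_powerEps_mul ?_, by rw [← hA']; ring⟩
  rw [← hA']
  exact MvPolynomial.IsHomogeneous.sub hA (LinForm.map (LinForm.map hA _) _)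

/-- Denominators of a polynomial over `ℂ((ε))` are cleared by a power of `ε`. -/
theorem exists_pow_mul_eq_ofPower {n : ℕ} (P : MvPolynomial (Fin n) (LaurentSeries ℂ)) :
    ∃ q : ℕ, ∀ q' ≥ q, ∃ F, MvPolynomial.C (laurentEps ^ q') * P = ofPower F := by
  -- `ℂ((ε))` is the localization of `ℂ[[ε]]` at the powers of `ε`, and only finitely many
  -- coefficients are nonzero.
  obtain ⟨⟨_, q, rfl⟩, hb⟩ := IsLocalization.exist_integer_multiples
    (Submonoid.powers (PowerSeries.X : PowerSeries ℂ)) P.support (fun m => P.coeff m)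
  refine ⟨q, fun q' hq' => ?_⟩
  suffices h : ∀ m, ∃ g, HahnSeries.ofPowerSeries ℤ ℂ g =
      (MvPolynomial.C (laurentEps ^ q') * P).coeff m by
    obtain ⟨F, hF⟩ := exists_ofPower_eq h
    exact ⟨F, hF.symm⟩
  intro m
  rw [MvPolynomial.coeff_C_mul]
  by_cases hm : m ∈ P.support
  · obtain ⟨g, hg⟩ := hb m hm
    refine ⟨PowerSeries.X ^ (q' - q) * g, ?_⟩
    rw [LaurentSeries.coe_algebraMap] at hg
    rw [map_mul, hg, Algebra.smul_def, LaurentSeries.coe_algebraMap, ← mul_assoc, ← map_mul,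
      ← pow_add, Nat.sub_add_cancel hq', map_pow, HahnSeries.ofPowerSeries_X]
    rfl
  · exact ⟨0, by simp [MvPolynomial.notMem_support_iff.1 hm]⟩

theorem LinForm.of_powerEps_pow_mul {n : ℕ} {F : MvPolynomial (Fin n) (PowerSeries ℂ)} (M : ℕ)
    (h : powerEps n ^ M * F ∈ LinForm n (PowerSeries ℂ)) : F ∈ LinForm n (PowerSeries ℂ) := by
  induction M with
  | zero => simpa using h
  | succ M ih => exact ih (LinForm.of_powerEps_mul (by rwa [← mul_assoc, ← pow_succ']))

/-- Setting `ε = 0` has kernel `(ε)` and lands in the domain `ℂ[x]`. -/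
theorem powerEps_prime (n : ℕ) : Prime (powerEps n) := by
  refine ⟨powerEps_ne_zero n, fun h => ?_, fun F G h => ?_⟩
  · have := powerEps_dvd_iff.1 (h.dvd (a := (1 : MvPolynomial (Fin n) (PowerSeries ℂ))))
    simp [constTerm] at this
  · rw [powerEps_dvd_iff] at h ⊢
    rw [powerEps_dvd_iff]
    rwa [constTerm, map_mul, mul_eq_zero] at h

/-- Two linear forms over `ℂ((ε))` become integral, and not both divisible by `ε`, after
multiplication by a power of `ε`, unless they are integral to begin with. -/
theorem exists_common_normalization {n : ℕ} {L₁ L₂ : MvPolynomial (Fin n) (LaurentSeries ℂ)}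
    (h₁ : L₁ ∈ LinForm n (LaurentSeries ℂ)) (h₂ : L₂ ∈ LinForm n (LaurentSeries ℂ)) :
    ∃ q : ℕ, ∃ A ∈ LinForm n (PowerSeries ℂ), ∃ B ∈ LinForm n (PowerSeries ℂ),
      MvPolynomial.C (laurentEps ^ q) * L₁ = ofPower A ∧
      MvPolynomial.C (laurentEps ^ q) * L₂ = ofPower B ∧
      (q = 0 ∨ constTerm A ≠ 0 ∨ constTerm B ≠ 0) := by
  classical
  have hex : ∃ q : ℕ, ∃ A B, MvPolynomial.C (laurentEps ^ q) * L₁ = ofPower A ∧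
      MvPolynomial.C (laurentEps ^ q) * L₂ = ofPower B := by
    obtain ⟨q₁, hq₁⟩ := exists_pow_mul_eq_ofPower L₁
    obtain ⟨q₂, hq₂⟩ := exists_pow_mul_eq_ofPower L₂
    obtain ⟨A, hA⟩ := hq₁ (max q₁ q₂) (le_max_left _ _)
    obtain ⟨B, hB⟩ := hq₂ (max q₁ q₂) (le_max_right _ _)
    exact ⟨_, A, B, hA, hB⟩
  obtain ⟨A, B, hA, hB⟩ := Nat.find_spec hex
  have hlin : ∀ {L F} (_ : L ∈ LinForm n (LaurentSeries ℂ))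
      (_ : MvPolynomial.C (laurentEps ^ Nat.find hex) * L = ofPower F),
      F ∈ LinForm n (PowerSeries ℂ) := fun {L F} hL hF =>
    MvPolynomial.IsHomogeneous.of_map HahnSeries.ofPowerSeries_injective
      (hF ▸ LinForm.C_mul hL _ : ofPower F ∈ LinForm n (LaurentSeries ℂ))
  refine ⟨Nat.find hex, A, hlin h₁ hA, B, hlin h₂ hB, hA, hB, ?_⟩
  -- If both forms were divisible by `ε` with `q > 0`, then `q - 1` would do, against minimality.
  by_contra! hcon
  obtain ⟨hq, hA0, hB0⟩ := hcon
  obtain ⟨k, hk⟩ := Nat.exists_eq_succ_of_ne_zero hq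
  obtain ⟨A', rfl⟩ := powerEps_dvd_iff.2 hA0
  obtain ⟨B', rfl⟩ := powerEps_dvd_iff.2 hB0
  have hcancel : ∀ {L : MvPolynomial (Fin n) (LaurentSeries ℂ)} {F}, MvPolynomial.C (laurentEps ^ Nat.find hex) * L =
      ofPower (powerEps n * F) → MvPolynomial.C (laurentEps ^ k) * L = ofPower F := by
    intro L F hF
    rw [hk, Nat.succ_eq_add_one, pow_succ', MvPolynomial.C_mul, mul_assoc, ofPower, map_mul,
      ← ofPower, ← ofPower, ofPower_powerEps] at hF
    exact mul_left_cancel₀ (by simp [laurentEps_ne_zero]) hF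
  exact Nat.find_min hex (by omega : k < Nat.find hex) ⟨A', B', hcancel hA, hcancel hB⟩

/-! ### The dichotomy between split and tangent decompositions. -/

/-- If the sum of the `d`-th powers of two linear forms over `ℂ[[ε]]` is divisible by `ε ^ M`,
`M ≥ 1`, and not both forms vanish at `ε = 0`, then up to a `d`-th root of `-1` they agree
modulo `ε ^ M`. -/
theorem exists_sub_eq_of_pow_add_pow {n d M : ℕ} (hd : d ≠ 0) (hM : M ≠ 0)
    {A B G : MvPolynomial (Fin n) (PowerSeries ℂ)} (hA : A ∈ LinForm n (PowerSeries ℂ))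
    (hB : B ∈ LinForm n (PowerSeries ℂ)) (h0 : constTerm A ≠ 0 ∨ constTerm B ≠ 0)
    (h : A ^ d + B ^ d = powerEps n ^ M * G) :
    ∃ D ∈ LinForm n (PowerSeries ℂ),
      B ^ d = -(A - powerEps n ^ M * D) ^ d ∧
      constTerm G = MvPolynomial.C (d : ℂ) * constTerm A ^ (d - 1) * constTerm D := by
  have hA0 : constTerm A ∈ LinForm n ℂ := LinForm.map hA _
  have hB0 : constTerm B ∈ LinForm n ℂ := LinForm.map hB _
  have h1 : constTerm A ^ d + constTerm B ^ d = 0 := by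
    have := congrArg constTerm h
    simp only [map_add, map_mul, map_pow] at this
    rwa [← constTerm, ← constTerm, ← constTerm, constTerm_powerEps, zero_pow hM, zero_mul] at this
  have hB00 : constTerm B ≠ 0 := fun hb => by
    rw [hb, zero_pow hd, add_zero] at h1
    exact h0.elim (fun h => h (eq_zero_of_pow_eq_zero h1)) (fun h => h hb)
  have hA00 : constTerm A ≠ 0 := fun ha => by
    rw [ha, zero_pow hd, zero_add] at h1
    exact hB00 (eq_zero_of_pow_eq_zero h1)
  obtain ⟨c, hc⟩ := LinForm.exists_eq_C_mul_of_pow hA0 hB0 hd one_ne_zero (β := 1)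
    (by simpa using h1)
  have hcd : c ^ d = -1 := by
    have h2 : MvPolynomial.C (c ^ d + 1) * constTerm B ^ d = 0 := by
      rw [hc, mul_pow, ← map_pow] at h1
      rw [map_add, map_one]
      linear_combination h1
    have h3 := (mul_eq_zero.1 h2).resolve_right (pow_ne_zero _ hB00)
    rw [MvPolynomial.C_eq_zero] at h3
    linear_combination h3
  set B' := MvPolynomial.C (PowerSeries.C c) * B with hB'
  have hB'lin : B' ∈ LinForm n (PowerSeries ℂ) := LinForm.C_mul hB _
  have hB'd : B' ^ d = -B ^ d := by
    rw [hB', mul_pow, ← map_pow, ← map_pow, hcd, map_neg, map_neg, map_one, map_one]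
    ring
  have hB'0 : constTerm B' = constTerm A := by
    rw [hc, hB', constTerm, map_mul]
    simp
  set S := ∑ i ∈ Finset.range d, A ^ i * B' ^ (d - 1 - i) with hS
  have hSmul : S * (A - B') = powerEps n ^ M * G := by
    rw [hS, (Commute.all A B').geom_sum₂_mul, hB'd, ← h]; ring
  have hS0 : constTerm S = MvPolynomial.C (d : ℂ) * constTerm A ^ (d - 1) := by
    rw [hS, constTerm, map_sum]
    simp only [map_mul, map_pow]
    rw [← constTerm, ← constTerm, hB'0, geom_sum₂_self]
    simp
  -- `ε` does not divide `S`, so all of `ε ^ M` divides `A - B'`.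
  obtain ⟨D, hD⟩ := (powerEps_prime n).pow_dvd_of_dvd_mul_left M
    (fun hdvd => by
      rw [powerEps_dvd_iff, hS0] at hdvd
      simp [hd, hA00] at hdvd) (Dvd.intro G hSmul.symm)
  refine ⟨D, LinForm.of_powerEps_pow_mul M ?_, ?_, ?_⟩
  · rw [← hD]
    exact MvPolynomial.IsHomogeneous.sub hA hB'lin
  · rw [← hD, sub_sub_cancel, hB'd, neg_neg]
  · have hG : S * D = G := by
      refine mul_left_cancel₀ (pow_ne_zero M (powerEps_ne_zero n)) ?_
      rw [← hSmul, hD]; ring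
    rw [← hG, constTerm, map_mul, ← constTerm, hS0]

/-- The cases are `q = 0` and `q > 0` for the minimal `q` clearing denominators. No assumption on
the rank is needed. -/
theorem IsBorderWaringDecomp.split_or_tangent {n d : ℕ} (hd : d ≠ 0)
    {f : MvPolynomial (Fin n) ℂ} {L : Fin 2 → MvPolynomial (Fin n) (RatFunc ℂ)}
    (h : IsBorderWaringDecomp d f L) :
    (∃ ℓ₁ ∈ LinForm n ℂ, ∃ ℓ₂ ∈ LinForm n ℂ, f = ℓ₁ ^ d + ℓ₂ ^ d ∧ HasSplitForm d ℓ₁ ℓ₂ L) ∨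
    (∃ ℓ₁ ∈ LinForm n ℂ, ∃ ℓ₂ ∈ LinForm n ℂ, f = ℓ₁ ^ (d - 1) * ℓ₂ ∧
      HasTangentForm d ℓ₁ ℓ₂ L) := by
  obtain ⟨hL, hlim⟩ := h
  obtain ⟨G, hG, hG0⟩ := hlim.exists_ofPower
  obtain ⟨q, A, hA, B, hB, hAL, hBL, hq⟩ := exists_common_normalization
    (LinForm.map (hL 0) (algebraMap (RatFunc ℂ) (LaurentSeries ℂ)))
    (LinForm.map (hL 1) (algebraMap (RatFunc ℂ) (LaurentSeries ℂ)))
  change MvPolynomial.C (laurentEps ^ q) * expandRat (L 0) = _ at hAL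
  change MvPolynomial.C (laurentEps ^ q) * expandRat (L 1) = _ at hBL
  have hsum : ofPower G = expandRat (L 0) ^ d + expandRat (L 1) ^ d := by
    rw [hG, Fin.sum_univ_two, expandRat, map_add, map_pow, map_pow]
    rfl
  have hAB : A ^ d + B ^ d = powerEps n ^ (q * d) * G := by
    refine ofPower_injective ?_
    have e1 : ofPower (A ^ d + B ^ d) = ofPower A ^ d + ofPower B ^ d := by
      simp [ofPower]
    have e2 : ofPower (powerEps n ^ (q * d) * G) =
        ofPower (powerEps n) ^ (q * d) * ofPower G := by simp [ofPower]
    rw [e1, e2, ← hAL, ← hBL, hsum, ofPower_powerEps, mul_pow, mul_pow, map_pow]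
    ring
  obtain ⟨A', hA', hA'e⟩ := LinForm.exists_eq_constForm_add hA
  obtain rfl | hq0 := eq_or_ne q 0
  · left
    obtain ⟨B', hB', hB'e⟩ := LinForm.exists_eq_constForm_add hB
    simp only [pow_zero, map_one, one_mul] at hAL hBL
    refine ⟨constTerm A, LinForm.map hA _, constTerm B, LinForm.map hB _, ?_,
      A', hA', B', hB', 1, ?_, ?_⟩
    · rw [← hG0]
      simp only [zero_mul, pow_zero, one_mul] at hAB
      rw [← hAB, constTerm, map_add, map_pow, map_pow]
    · rw [← hA'e, ← hAL]; rfl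
    · rw [← hB'e, ← hBL]; rfl
  · right
    obtain ⟨D, hD, hBd, hf⟩ := exists_sub_eq_of_pow_add_pow hd (Nat.mul_ne_zero hq0 hd) hA hB
      (hq.resolve_left hq0) hAB
    obtain ⟨D', hD', hD'e⟩ := LinForm.exists_eq_constForm_add hD
    obtain ⟨N, hN⟩ := Nat.exists_eq_succ_of_ne_zero (Nat.mul_ne_zero hq0 hd)
    have hdC : (d : ℂ) ≠ 0 := Nat.cast_ne_zero.2 hd
    have hpow : ∀ {P : MvPolynomial (Fin n) (LaurentSeries ℂ)} {F}, MvPolynomial.C (laurentEps ^ q) * P = ofPower F →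
        P ^ d = MvPolynomial.C ((laurentEps ^ (q * d))⁻¹) * ofPower F ^ d := by
      intro P F hPF
      rw [← hPF, mul_pow, ← map_pow, ← pow_mul, ← mul_assoc, ← map_mul,
        inv_mul_cancel₀ (pow_ne_zero _ laurentEps_ne_zero), map_one, one_mul]
    have hD0 : constForm (MvPolynomial.C (1 / (1 ^ (d - 1) * (d : ℂ))) *
        (MvPolynomial.C (d : ℂ) * constTerm D) + 0) = constForm (constTerm D) := by
      rw [← mul_assoc, ← map_mul, one_pow, one_mul, one_div, inv_mul_cancel₀ hdC, map_one, one_mul,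
        add_zero]
    have h00 : constForm (0 : MvPolynomial (Fin n) ℂ) = 0 := map_zero _
    have hpe : powerEps n ^ (q * d) = powerEps n * powerEps n ^ N := by
      rw [hN, Nat.succ_eq_add_one, pow_succ']
    -- Here `M = q * d`, `a = 1`, `ℓ₃ = 0` and `ℓ₂ = d D₀`. The choice of `ℓ̂₁` gives `ℓ₁ + ε ℓ̂₁ =
    -- A - ε^M D₀`, so the first base is `A`; with `ℓ̂₂ = -D'` the second is `A - ε^M D`.
    refine ⟨constTerm A, LinForm.map hA _, MvPolynomial.C (d : ℂ) * constTerm D,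
      LinForm.C_mul (LinForm.map hD _) _, by rw [← hG0, hf]; ring, q * d,
      Nat.one_le_iff_ne_zero.2 (Nat.mul_ne_zero hq0 hd), 1, one_ne_zero, 0,
      MvPolynomial.isHomogeneous_zero _ _ _,
      A' - powerEps n ^ N * constForm (constTerm D), ?_, -D', MvPolynomial.IsHomogeneous.neg hD',
      ?_, ?_⟩
    · refine MvPolynomial.IsHomogeneous.sub hA' ?_
      rw [powerEps, ← map_pow]
      exact LinForm.C_mul (LinForm.map (LinForm.map hD _) _) _
    · rw [hpow hAL, hD0]
      congr 3
      rw [hpe, map_one, one_mul]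
      linear_combination hA'e
    · rw [hpow hBL]
      have e1 : ofPower B ^ d = -ofPower (A - powerEps n ^ (q * d) * D) ^ d := by
        simpa [ofPower] using congrArg ofPower hBd
      have e2 : ∀ P Q : MvPolynomial (Fin n) (LaurentSeries ℂ), P * -Q = -(P * Q) :=
        fun P Q => by ring
      rw [e1, e2, h00]
      congr 4
      rw [hpe, map_one, one_mul]
      linear_combination hA'e - powerEps n * powerEps n ^ N * hD'e

/-! ### Rescaling normal forms -/

theorem HasSplitForm.symm {n d : ℕ} {ℓ m : MvPolynomial (Fin n) ℂ}
    {L : Fin 2 → MvPolynomial (Fin n) (RatFunc ℂ)} (h : HasSplitForm d ℓ m L) :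
    HasSplitForm d m ℓ L := by
  obtain ⟨h₁, hh₁, h₂, hh₂, π, e₁, e₂⟩ := h
  exact ⟨h₂, hh₂, h₁, hh₁, π * Equiv.swap 0 1, by simpa using e₂, by simpa using e₁⟩

/-- Pulled out of the whole base, a `d`-th root of unity disappears in the power. -/
theorem ofPower_rescale_pow {n d : ℕ} {a ℓ : MvPolynomial (Fin n) ℂ} {c : ℂ} (hd : d ≠ 0)
    (ha : a = MvPolynomial.C c * ℓ) (hc : c ^ d = 1)
    (h : MvPolynomial (Fin n) (PowerSeries ℂ)) :
    ofPower (constForm a + powerEps n * h) ^ d =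
      ofPower (constForm ℓ + powerEps n * (MvPolynomial.C (PowerSeries.C c⁻¹) * h)) ^ d := by
  have hc0 : c ≠ 0 := by
    rintro rfl
    simp [hd] at hc
  have e1 : constForm a + powerEps n * h = MvPolynomial.C (PowerSeries.C c) *
      (constForm ℓ + powerEps n * (MvPolynomial.C (PowerSeries.C c⁻¹) * h)) := by
    have e2 : constForm a = MvPolynomial.C (PowerSeries.C c) * constForm ℓ := by
      simp [ha, constForm]
    have e3 : (MvPolynomial.C (PowerSeries.C c) : MvPolynomial (Fin n) (PowerSeries ℂ)) *
        MvPolynomial.C (PowerSeries.C c⁻¹) = 1 := by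
      rw [← map_mul, ← map_mul, mul_inv_cancel₀ hc0, map_one, map_one]
    rw [e2]
    linear_combination -(powerEps n * h) * e3
  have e4 : ∀ P Q : MvPolynomial (Fin n) (PowerSeries ℂ), P ^ d = Q ^ d →
      ofPower P ^ d = ofPower Q ^ d := fun P Q hPQ => by
    simpa [ofPower] using congrArg ofPower hPQ
  apply e4
  rw [e1, mul_pow, ← map_pow, ← map_pow, hc, map_one, map_one, one_mul]

theorem HasSplitForm.rescale {n d : ℕ} (hd : d ≠ 0) {a b ℓ m : MvPolynomial (Fin n) ℂ}
    {L : Fin 2 → MvPolynomial (Fin n) (RatFunc ℂ)} (h : HasSplitForm d a b L) {c c' : ℂ}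
    (ha : a = MvPolynomial.C c * ℓ) (hb : b = MvPolynomial.C c' * m) (hc : c ^ d = 1)
    (hc' : c' ^ d = 1) : HasSplitForm d ℓ m L := by
  obtain ⟨h₁, hh₁, h₂, hh₂, π, e₁, e₂⟩ := h
  exact ⟨_, LinForm.C_mul hh₁ _, _, LinForm.C_mul hh₂ _, π,
    e₁.trans (ofPower_rescale_pow hd ha hc h₁), e₂.trans (ofPower_rescale_pow hd hb hc' h₂)⟩

/-- The free constant of the tangent form absorbs the scaling: `z` becomes `z * c`, and `c ^ (d -
1)` cancels in the coefficient of `m`. -/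
theorem HasTangentForm.rescale {n d : ℕ} {a b ℓ m : MvPolynomial (Fin n) ℂ}
    {L : Fin 2 → MvPolynomial (Fin n) (RatFunc ℂ)} (h : HasTangentForm d a b L) {c : ℂ}
    (hc : c ≠ 0) (ha : a = MvPolynomial.C c * ℓ)
    (hm : m = MvPolynomial.C (c ^ (d - 1)) * b) : HasTangentForm d ℓ m L := by
  obtain ⟨M, hM, z, hz, ℓ₃, hℓ₃, h₁, hh₁, h₂, hh₂, e₁, e₂⟩ := h
  have ea : MvPolynomial.C (z * c) * ℓ = MvPolynomial.C z * a := by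
    rw [ha, MvPolynomial.C_mul, mul_assoc]
  have eb : MvPolynomial.C (1 / ((z * c) ^ (d - 1) * (d : ℂ))) * m =
      MvPolynomial.C (1 / (z ^ (d - 1) * (d : ℂ))) * b := by
    rw [hm, ← mul_assoc, ← map_mul]
    congr 2
    have := pow_ne_zero (d - 1) hc
    rw [mul_pow, mul_right_comm, one_div, mul_inv, inv_mul_cancel_right₀ this, one_div]
  refine ⟨M, hM, z * c, mul_ne_zero hz hc, ℓ₃, hℓ₃, h₁, hh₁, h₂, hh₂, ?_, ?_⟩
  · rw [ea, eb]; exact e₁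
  · rw [ea]; exact e₂

/-! ### Border Waring rank -/

theorem isBorderWaringDecomp_linForm_pow {n : ℕ} (d : ℕ) {ℓ : MvPolynomial (Fin n) ℂ}
    (hℓ : ℓ ∈ LinForm n ℂ) :
    IsBorderWaringDecomp d (ℓ ^ d)
      (fun _ : Fin 1 => MvPolynomial.map (RatFunc.C (K := ℂ)) ℓ) := by
  refine ⟨fun _ => LinForm.map hℓ _, fun m => ?_⟩
  rw [Fin.sum_univ_one, ← map_pow, MvPolynomial.coeff_map]
  simp only [RatFunc.eval_C, RingHom.id_apply]
  exact tendsto_const_nhds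

theorem notPowLinForm_of_borderWaringRank {n d : ℕ} {f : MvPolynomial (Fin n) ℂ}
    (hr : borderWaringRank d f = 2) : NotPowLinForm d f := by
  rintro ℓ hℓ rfl
  have : borderWaringRank d (ℓ ^ d) ≤ 1 :=
    Nat.sInf_le ⟨_, isBorderWaringDecomp_linForm_pow d hℓ⟩
  omega

/-- The value `0` is excluded because `sInf ∅ = 0`; a positive infimum is attained. -/
theorem exists_isBorderWaringDecomp_of_borderWaringRank {n d r : ℕ} {f : MvPolynomial (Fin n) ℂ}
    (hr : borderWaringRank d f = r) (hr0 : r ≠ 0) :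
    ∃ L : Fin r → MvPolynomial (Fin n) (RatFunc ℂ), IsBorderWaringDecomp d f L := by
  subst hr
  exact Nat.sInf_mem (Nat.nonempty_of_pos_sInf (Nat.pos_of_ne_zero hr0))

theorem IsBorderWaringDecomp.hasSplitForm {n e : ℕ} (he : e ≠ 0) {ℓ m : MvPolynomial (Fin n) ℂ}
    (hℓ : ℓ ∈ LinForm n ℂ) (hm : m ∈ LinForm n ℂ)
    (hf : NotPowLinForm (e + 2) (ℓ ^ (e + 2) + m ^ (e + 2)))
    {L : Fin 2 → MvPolynomial (Fin n) (RatFunc ℂ)}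
    (hL : IsBorderWaringDecomp (e + 2) (ℓ ^ (e + 2) + m ^ (e + 2)) L) :
    HasSplitForm (e + 2) ℓ m L := by
  obtain ⟨a, ha, b, hb, hab, hform⟩ | ⟨a, ha, b, hb, hab, -⟩ :=
    hL.split_or_tangent (by omega)
  · have hf' := hf
    rw [hab] at hf'
    obtain ⟨c, hc⟩ | ⟨c, hc⟩ := hf'.proportional_left he ha hb hℓ hm hab.symm
    · obtain ⟨c', hc', h1, h2⟩ := hf.unique_of_proportional he hℓ hm ha hb hab hc
      exact hform.rescale (by omega) hc hc' h1 h2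
    -- The summands match in the opposite order, which the permutation in `HasSplitForm` allows.
    · rw [add_comm (ℓ ^ (e + 2))] at hf hab
      obtain ⟨c', hc', h1, h2⟩ := hf.unique_of_proportional he hm hℓ ha hb hab hc
      exact (hform.rescale (by omega) hc hc' h1 h2).symm
  · exact absurd hab (hf.split_ne_tangent he hℓ hm ha hb)

theorem IsBorderWaringDecomp.hasTangentForm {n e : ℕ} {ℓ m : MvPolynomial (Fin n) ℂ}
    (hℓ : ℓ ∈ LinForm n ℂ) (hm : m ∈ LinForm n ℂ) (hf : NotPowLinForm (e + 3) (ℓ ^ (e + 2) * m))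
    {L : Fin 2 → MvPolynomial (Fin n) (RatFunc ℂ)}
    (hL : IsBorderWaringDecomp (e + 3) (ℓ ^ (e + 2) * m) L) :
    HasTangentForm (e + 3) ℓ m L := by
  obtain ⟨a, ha, b, hb, hab, -⟩ | ⟨a, ha, b, hb, hab, hform⟩ :=
    hL.split_or_tangent (by omega)
  · rw [hab] at hf
    exact absurd hab.symm (hf.split_ne_tangent (Nat.succ_ne_zero e) ha hb hℓ hm)
  · have hab' : ℓ ^ (e + 2) * m = a ^ (e + 2) * b := hab
    rw [hab'] at hf
    obtain ⟨c, hc0, hc, hc'⟩ := hf.tangent_unique hℓ hm ha hb hab'.symm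
    exact hform.rescale hc0 hc hc'

theorem mainTheorem8 (n d : ℕ) (hd : 1 ≤ d) (f : MvPolynomial (Fin n) ℂ)
    (hf : f.IsHomogeneous d) (hr : borderWaringRank d f = 2) :
    -- normal forms
    (∃ ℓ₁ ∈ LinForm n ℂ, ∃ ℓ₂ ∈ LinForm n ℂ,
      f = ℓ₁ ^ d + ℓ₂ ^ d ∨ f = ℓ₁ ^ (d - 1) * ℓ₂) ∧
    -- every border rank decomposition belongs to one of the two cases
    (∀ L : Fin 2 → MvPolynomial (Fin n) (RatFunc ℂ), IsBorderWaringDecomp d f L →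
      ∃ ℓ₁ ∈ LinForm n ℂ, ∃ ℓ₂ ∈ LinForm n ℂ,
        (f = ℓ₁ ^ d + ℓ₂ ^ d ∧ HasSplitForm d ℓ₁ ℓ₂ L) ∨
        (f = ℓ₁ ^ (d - 1) * ℓ₂ ∧ HasTangentForm d ℓ₁ ℓ₂ L)) ∧
    -- for `d ≥ 3` the case depends on `f` only, and any normal form of `f` may be used
    (3 ≤ d →
      (∀ ℓ₁ ∈ LinForm n ℂ, ∀ ℓ₂ ∈ LinForm n ℂ, f = ℓ₁ ^ d + ℓ₂ ^ d →
        ∀ L : Fin 2 → MvPolynomial (Fin n) (RatFunc ℂ), IsBorderWaringDecomp d f L →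
          HasSplitForm d ℓ₁ ℓ₂ L) ∧
      (∀ ℓ₁ ∈ LinForm n ℂ, ∀ ℓ₂ ∈ LinForm n ℂ, f = ℓ₁ ^ (d - 1) * ℓ₂ →
        ∀ L : Fin 2 → MvPolynomial (Fin n) (RatFunc ℂ), IsBorderWaringDecomp d f L →
          HasTangentForm d ℓ₁ ℓ₂ L)) := by
  have hnp := notPowLinForm_of_borderWaringRank hr
  have hd0 : d ≠ 0 := by omega
  refine ⟨?_, ?_, ?_⟩
  · obtain ⟨L, hL⟩ := exists_isBorderWaringDecomp_of_borderWaringRank hr two_ne_zero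
    obtain ⟨a, ha, b, hb, hab, -⟩ | ⟨a, ha, b, hb, hab, -⟩ := hL.split_or_tangent hd0
    · exact ⟨a, ha, b, hb, Or.inl hab⟩
    · exact ⟨a, ha, b, hb, Or.inr hab⟩
  · intro L hL
    obtain ⟨a, ha, b, hb, hab⟩ | ⟨a, ha, b, hb, hab⟩ := hL.split_or_tangent hd0
    · exact ⟨a, ha, b, hb, Or.inl hab⟩
    · exact ⟨a, ha, b, hb, Or.inr hab⟩
  · intro hd3
    obtain ⟨e, rfl⟩ := Nat.exists_eq_add_of_le' hd3
    constructor
    · rintro ℓ hℓ m hm rfl L hL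
      exact IsBorderWaringDecomp.hasSplitForm (Nat.succ_ne_zero e) hℓ hm hnp hL
    · rintro ℓ hℓ m hm rfl L hL
      exact IsBorderWaringDecomp.hasTangentForm hℓ hm hnp hL
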